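/- All rings are commutative and all modules are finitely generated. Let $T$ be a Noetherian ring that is an algebra over a local ring, let $f\in T$ be a nonzerodivisor, put $R=T/(f)$, and let $M$ be an $R$-module. An $R$-module $L$ is called liftable to $T$ if there is a $T$-module $L'$ with $L'\otimes_T R\cong L$ and $\operatorname{Tor}_i^T(L',R)=0$ for all $i>0$; $M$ is called weakly liftable to $T$ if it is a direct summand of an $R$-module that is liftable to $T$. Choose any surjection $\pi: T^a\to M$ of $T$-modules, let $W=\operatorname{syz}_1^T M=\ker\pi$, and let $\theta: M\to W/fW$ be the $R$-linear map $\theta(\pi(x))=fx+fW$. For an $R$-module $N$ and $i\ge 0$ let $$\alpha_i:\operatorname{Tor}_{i+2}^R(M,N)\to\operatorname{Tor}_i^R(M,N)$$ be the connecting map of the change-of-rings long exact sequence $$\cdots\to\operatorname{Tor}_{i+2}^T(M,N)\to\operatorname{Tor}_{i+2}^R(M,N)\xrightarrow{\ \alpha_i\ }\operatorname{Tor}_i^R(M,N)\to\operatorname{Tor}_{i+1}^T(M,N)\to\cdots .$$ Then the following are equivalent: 1. $M$ is weakly liftable to $T$; 2. $\theta: M\to W/fW$ is a split monomorphism of $R$-modules,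 i.e. there is an $R$-linear map $\rho: W/fW\to M$ with $\rho\circ\theta=\mathrm{id}_M$; 3. for every $R$-module $N$, the map $\alpha_0:\operatorname{Tor}_2^R(M,N)\to\operatorname{Tor}_0^R(M,N)$ is zero; 4. for every $R$-module $N$ and every integer $i\ge 0$, the map $\alpha_i:\operatorname{Tor}_{i+2}^R(M,N)\to\operatorname{Tor}_i^R(M,N)$ is zero. -/

import Mathlib

universe u

noncomputable section

open CategoryTheory MonoidalCategory
open scoped Pointwise

/-! ### Liftable and weakly liftable modules -/

section Lifting

variable (T R : Type u) [CommRing T] [CommRing R] [Algebra T R]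

/-- An `R`-module `L` lifts to `T` if there is a finitely generated `T`-module `L'` with
`R ⊗[T] L' ≅ L` as `R`-modules and `Tor_i^T(L', R) = 0` for all `i > 0`. -/
def IsLiftable (L : Type u) [AddCommGroup L] [Module R L] : Prop :=
  ∃ (L' : Type u) (_ : AddCommGroup L') (_ : Module T L'), Module.Finite T L' ∧
    Nonempty ((TensorProduct T R L') ≃ₗ[R] L) ∧
    ∀ i : ℕ, 0 < i → Limits.IsZero
      (((Tor (ModuleCat.{u} T) i).obj (ModuleCat.of T L')).obj (ModuleCat.of T R))

/-- An `R`-module is weakly liftable to `T` if it is a direct summand of a finitely generated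
`R`-module that lifts to `T`. -/
def IsWeaklyLiftable (M : Type u) [AddCommGroup M] [Module R M] : Prop :=
  ∃ (L : Type u) (_ : AddCommGroup L) (_ : Module R L), Module.Finite R L ∧
    IsLiftable T R L ∧
    ∃ (j : M →ₗ[R] L) (q : L →ₗ[R] M), q ∘ₗ j = LinearMap.id

end Lifting

/-! ### The connecting maps of the long exact `Tor` sequence -/

namespace TorConnecting

variable {R : Type u} [CommRing R]

/-- A short exact sequence `0 → X₁ → X₂ → X₃ → 0` tensored with the projective resolution of `N`
by which `Tor` is computed. -/
def complexes (S : ShortComplex (ModuleCat.{u} R)) (N : ModuleCat.{u} R) :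
    ShortComplex (ChainComplex (ModuleCat.{u} R) ℕ) where
  X₁ := (((tensoringLeft (ModuleCat.{u} R)).obj S.X₁).mapHomologicalComplex _).obj
    (projectiveResolution N).complex
  X₂ := (((tensoringLeft (ModuleCat.{u} R)).obj S.X₂).mapHomologicalComplex _).obj
    (projectiveResolution N).complex
  X₃ := (((tensoringLeft (ModuleCat.{u} R)).obj S.X₃).mapHomologicalComplex _).obj
    (projectiveResolution N).complex
  f := (NatTrans.mapHomologicalComplex ((tensoringLeft (ModuleCat.{u} R)).map S.f) _).app _
  g := (NatTrans.mapHomologicalComplex ((tensoringLeft (ModuleCat.{u} R)).map S.g) _).app _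
  zero := by
    ext n : 1
    change (S.f ▷ _) ≫ (S.g ▷ _) = 0
    rw [← comp_whiskerRight, S.zero]
    exact MonoidalPreadditive.zero_whiskerRight

theorem complexes_shortExact {S : ShortComplex (ModuleCat.{u} R)} (hS : S.ShortExact)
    (N : ModuleCat.{u} R) : (complexes S N).ShortExact := by
  refine HomologicalComplex.shortExact_of_degreewise_shortExact _ fun n => ?_
  have hp : Projective ((projectiveResolution N).complex.X n) := inferInstance
  have : Module.Projective R ((projectiveResolution N).complex.X n) :=
    (IsProjective.iff_projective _).2 hp
  exact hS.map_of_exact (tensorRight ((projectiveResolution N).complex.X n))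

/-- The connecting map `Tor_{n+1}^R(X₃, N) → Tor_n^R(X₁, N)` of a short exact sequence
`0 → X₁ → X₂ → X₃ → 0` of `R`-modules. -/
def torδ {S : ShortComplex (ModuleCat.{u} R)} (hS : S.ShortExact) (N : ModuleCat.{u} R) (n : ℕ) :
    ((Tor (ModuleCat.{u} R) (n + 1)).obj S.X₃).obj N ⟶
      ((Tor (ModuleCat.{u} R) n).obj S.X₁).obj N :=
  ((projectiveResolution N).isoLeftDerivedObj
      ((tensoringLeft (ModuleCat.{u} R)).obj S.X₃) (n + 1)).hom ≫
    (complexes_shortExact hS N).δ (n + 1) n rfl ≫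
    ((projectiveResolution N).isoLeftDerivedObj
      ((tensoringLeft (ModuleCat.{u} R)).obj S.X₁) n).inv

end TorConnecting

/-! ### Reduction modulo `f` of a presentation -/

namespace ChangeOfRings

variable {T : Type u} [CommRing T] (f : T)

instance (X : Type u) [AddCommGroup X] [Module T X] :
    IsScalarTower T (T ⧸ Ideal.span {f}) (QuotSMulTop f X) where
  smul_assoc t r x := by
    obtain ⟨r, rfl⟩ := Ideal.Quotient.mk_surjective r
    obtain ⟨x, rfl⟩ := Submodule.Quotient.mk_surjective _ x
    exact congrArg (Submodule.Quotient.mk (p := f • (⊤ : Submodule T X))) (mul_smul t r x)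

theorem algebraMap_surjective :
    Function.Surjective (algebraMap T (T ⧸ Ideal.span {f})) := Ideal.Quotient.mk_surjective

theorem smul_eq_zero {M : Type u} [AddCommGroup M] [Module T M] [Module (T ⧸ Ideal.span {f}) M]
    [IsScalarTower T (T ⧸ Ideal.span {f}) M] (m : M) : f • m = 0 := by
  rw [← algebraMap_smul (T ⧸ Ideal.span {f}) f m,
    show algebraMap T (T ⧸ Ideal.span {f}) f = 0 from
      Ideal.Quotient.eq_zero_iff_mem.2 (Ideal.mem_span_singleton_self f), zero_smul]

variable {M : Type u} [AddCommGroup M] [Module T M] [Module (T ⧸ Ideal.span {f}) M]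
  [IsScalarTower T (T ⧸ Ideal.span {f}) M]
  {P : Type u} [AddCommGroup P] [Module T P] (p : P →ₗ[T] M)

/-- For `W = ker p`, the map `P → W / fW`, `x ↦ f x + fW`. -/
def mulMap : P →ₗ[T] QuotSMulTop f (LinearMap.ker p) :=
  (f • (⊤ : Submodule T (LinearMap.ker p))).mkQ ∘ₗ
    (LinearMap.lsmul T P f).codRestrict (LinearMap.ker p) fun x => by
      simp [smul_eq_zero f]

theorem ker_le_ker_mulMap : LinearMap.ker p ≤ LinearMap.ker (mulMap f p) := fun x hx => by
  rw [LinearMap.mem_ker, mulMap, LinearMap.comp_apply, Submodule.mkQ_apply,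
    Submodule.Quotient.mk_eq_zero]
  exact Submodule.smul_mem_pointwise_smul (⟨x, hx⟩ : LinearMap.ker p) f ⊤ trivial

/-- The map `θ : M → W / fW` for a surjection `p : P → M` with kernel `W` (the first syzygy of
`M` over `T`): `θ (p x) = f x + fW`. -/
def theta (hp : Function.Surjective p) :
    M →ₗ[T ⧸ Ideal.span {f}] QuotSMulTop f (LinearMap.ker p) :=
  LinearMap.extendScalarsOfSurjective (algebraMap_surjective f)
    ((LinearMap.ker p).liftQ (mulMap f p) (ker_le_ker_mulMap f p) ∘ₗ
      (p.quotKerEquivOfSurjective hp).symm.toLinearMap)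

theorem theta_apply (hp : Function.Surjective p) (x : P) :
    theta f p hp (p x) = Submodule.Quotient.mk ⟨f • x, by simp [smul_eq_zero f]⟩ := by
  have : (p.quotKerEquivOfSurjective hp).symm (p x) = Submodule.Quotient.mk x := by
    rw [LinearEquiv.symm_apply_eq]; rfl
  change (LinearMap.ker p).liftQ (mulMap f p) (ker_le_ker_mulMap f p) ((p.quotKerEquivOfSurjective hp).symm (p x)) = _
  rw [this]
  rfl

/-- The map `P / fP → M` induced by `p : P → M`. -/
def reduced : QuotSMulTop f P →ₗ[T ⧸ Ideal.span {f}] M :=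
  LinearMap.extendScalarsOfSurjective (algebraMap_surjective f)
    ((f • (⊤ : Submodule T P)).liftQ p (by
      intro x hx
      obtain ⟨y, -, rfl⟩ := (Submodule.mem_smul_pointwise_iff_exists _ _ _).1 hx
      simp [smul_eq_zero f]))

/-- The map `W / fW → P / fP` induced by the inclusion of `W = ker p`. -/
def syzMap : QuotSMulTop f (LinearMap.ker p) →ₗ[T ⧸ Ideal.span {f}] QuotSMulTop f P :=
  LinearMap.extendScalarsOfSurjective (algebraMap_surjective f)
    (QuotSMulTop.map f (LinearMap.ker p).subtype)

/-- `W / fW` maps onto the kernel of `P / fP → M`, the first syzygy of `M` over `T / (f)`. -/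
def toSyz : QuotSMulTop f (LinearMap.ker p) →ₗ[T ⧸ Ideal.span {f}] LinearMap.ker (reduced f p) :=
  (syzMap f p).codRestrict _ fun w => by
    obtain ⟨w, rfl⟩ := Submodule.Quotient.mk_surjective _ w
    exact w.2

/-- The sequence `0 → M → W / fW → ker (P / fP → M) → 0`. -/
def leftSeq (hp : Function.Surjective p) : ShortComplex (ModuleCat.{u} (T ⧸ Ideal.span {f})) :=
  ShortComplex.mk (ModuleCat.ofHom (theta f p hp)) (ModuleCat.ofHom (toSyz f p)) (by
    refine ModuleCat.hom_ext (LinearMap.ext fun m => ?_)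
    obtain ⟨x, rfl⟩ := hp m
    change toSyz f p (theta f p hp (p x)) = 0
    rw [theta_apply]
    apply Subtype.ext
    exact (Submodule.Quotient.mk_eq_zero _).2
      (Submodule.smul_mem_pointwise_smul x f ⊤ trivial))

/-- The sequence `0 → ker (P / fP → M) → P / fP → M → 0`. -/
def rightSeq : ShortComplex (ModuleCat.{u} (T ⧸ Ideal.span {f})) :=
  ShortComplex.mk (ModuleCat.ofHom (LinearMap.ker (reduced f p)).subtype)
    (ModuleCat.ofHom (reduced f p)) (by
      ext x
      exact x.2)

variable {f}

theorem leftSeq_shortExact (hf : IsSMulRegular P f) (hp : Function.Surjective p) :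
    (leftSeq f p hp).ShortExact := by
  refine ShortComplex.ShortExact.mk' ?_ ?_ ?_
  · rw [ShortComplex.ShortExact.moduleCat_exact_iff_function_exact]
    intro w
    refine ⟨fun hw => ?_, ?_⟩
    · obtain ⟨w, rfl⟩ := Submodule.Quotient.mk_surjective _ w
      have h : (Submodule.Quotient.mk (w : P) : QuotSMulTop f P) = 0 := congrArg Subtype.val hw
      obtain ⟨x, -, hx⟩ := (Submodule.mem_smul_pointwise_iff_exists _ _ _).1
        ((Submodule.Quotient.mk_eq_zero _).1 h)
      refine ⟨p x, (theta_apply f p hp x).trans ?_⟩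
      exact congrArg Submodule.Quotient.mk (Subtype.ext hx)
    · rintro ⟨m, rfl⟩
      exact congrArg (fun g => g.hom m) (leftSeq f p hp).zero
  · rw [ModuleCat.mono_iff_injective]
    refine (injective_iff_map_eq_zero (theta f p hp)).2 fun m hm => ?_
    obtain ⟨x, rfl⟩ := hp m
    rw [theta_apply, Submodule.Quotient.mk_eq_zero] at hm
    obtain ⟨w, -, hw⟩ := (Submodule.mem_smul_pointwise_iff_exists _ _ _).1 hm
    have : (w : P) = x := hf (congrArg Subtype.val hw)
    rw [← this]
    exact w.2
  · rw [ModuleCat.epi_iff_surjective]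
    rintro ⟨x, hx⟩
    obtain ⟨x, rfl⟩ := Submodule.Quotient.mk_surjective _ x
    exact ⟨Submodule.Quotient.mk ⟨x, hx⟩, rfl⟩

theorem rightSeq_shortExact (hp : Function.Surjective p) : (rightSeq f p).ShortExact := by
  refine ShortComplex.ShortExact.mk' ?_ ?_ ?_
  · rw [ShortComplex.ShortExact.moduleCat_exact_iff_function_exact]
    intro x
    exact ⟨fun hx => ⟨⟨x, hx⟩, rfl⟩, by rintro ⟨y, rfl⟩; exact y.2⟩
  · rw [ModuleCat.mono_iff_injective]
    exact Subtype.val_injective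
  · rw [ModuleCat.epi_iff_surjective]
    intro m
    obtain ⟨x, rfl⟩ := hp m
    exact ⟨Submodule.Quotient.mk x, rfl⟩

/-- The connecting map `α_i : Tor_{i+2}^R(M, N) → Tor_i^R(M, N)` of the change-of-rings long exact
sequence
`⋯ → Tor_{i+2}^T(M, N) → Tor_{i+2}^R(M, N) → Tor_i^R(M, N) → Tor_{i+1}^T(M, N) → ⋯`
for `R = T / (f)`, with `f` a nonzerodivisor, computed from a projective `T`-module `P` and a
surjection `p : P → M` with kernel `W`.

Write `S = ker (P / fP → M)`. Since `P / fP` is `R`-projective, the connecting maps of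
`0 → S → P / fP → M → 0` identify `Tor_{n+1}^R(M, N)` with `Tor_n^R(S, N)` for `n > 0`. Since `f`
is regular on `W` and `P` is `T`-projective,
`Tor_n^R(W / fW, N) = Tor_n^T(W, N) = Tor_{n+1}^T(M, N)` for `n > 0`. With these identifications
the `Tor` sequence of `0 → M → W / fW → S → 0` is the change-of-rings sequence, and its connecting
map is the composite below. Equivalently, it is the differential `E²_{i+2,0} → E²_{i,1}` of the
spectral sequence `Tor_a^R(Tor_b^T(M, R), N) ⇒ Tor_{a+b}^T(M, N)`, in which
`Tor_0^T(M, R) = Tor_1^T(M, R) = M` and the other rows vanish. -/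
def alpha (hf : f ∈ nonZeroDivisors T) [Module.Projective T P] (hp : Function.Surjective p)
    (N : Type u) [AddCommGroup N] [Module (T ⧸ Ideal.span {f}) N] (i : ℕ) :
    ((Tor (ModuleCat.{u} (T ⧸ Ideal.span {f})) (i + 2)).obj
        (ModuleCat.of (T ⧸ Ideal.span {f}) M)).obj (ModuleCat.of (T ⧸ Ideal.span {f}) N) ⟶
      ((Tor (ModuleCat.{u} (T ⧸ Ideal.span {f})) i).obj
        (ModuleCat.of (T ⧸ Ideal.span {f}) M)).obj (ModuleCat.of (T ⧸ Ideal.span {f}) N) :=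
  TorConnecting.torδ (rightSeq_shortExact (f := f) p hp) (ModuleCat.of _ N) (i + 1) ≫
    TorConnecting.torδ
      (leftSeq_shortExact p (Module.Flat.isSMulRegular_of_nonZeroDivisors hf) hp)
      (ModuleCat.of _ N) i

end ChangeOfRings

end

/-
The map `θ` is natural in `M` up to a map between syzygies, and it splits when `M = L / fL` with
`f` regular on `L`, by division by `f` on `fL`; hence it splits for every weakly liftable `M`, a
retract of such an `L / fL`. Conversely, a splitting of `θ` makes `M` a direct summand of `W / fW`,
which lifts to `W`: as `0 → T → T → T / (f) → 0` resolves `T / (f)`, the modules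
`Tor_i^T(W, T / (f))` with `i > 0` vanish if and only if `f` is regular on `W`.

The map `α_i` is the composite of the connecting maps of `0 → S → P / fP → M → 0` and
`0 → M → W / fW → S → 0`, where the map from `M` is `θ`. If `θ` splits, the second connecting map
vanishes. If `i = 0`, the first one is an epimorphism since `P / fP` is flat, so `α₀ = 0` says that
`θ ⊗ N` is injective. If this holds for all `N`, then `θ` is a pure monomorphism, and a pure
monomorphism with finitely presented cokernel splits.
-/

noncomputable section

open CategoryTheory MonoidalCategory
open scoped Pointwise

/-- A split monomorphism of modules. -/
def IsSplitInjective {R M X : Type*} [Semiring R] [AddCommMonoid M] [AddCommMonoid X] [Module R M]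
    [Module R X] (i : M →ₗ[R] X) : Prop :=
  ∃ ρ : X →ₗ[R] M, ρ ∘ₗ i = LinearMap.id

theorem IsSplitInjective.of_retract {R M X M' X' : Type*} [Semiring R] [AddCommMonoid M]
    [AddCommMonoid X] [AddCommMonoid M'] [AddCommMonoid X'] [Module R M] [Module R X]
    [Module R M'] [Module R X'] {i : M →ₗ[R] X} {i' : M' →ₗ[R] X'} (hi' : IsSplitInjective i')
    {g : X →ₗ[R] X'} {j : M →ₗ[R] M'} {q : M' →ₗ[R] M} (hg : g ∘ₗ i = i' ∘ₗ j)
    (hqj : q ∘ₗ j = LinearMap.id) : IsSplitInjective i := by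
  obtain ⟨ρ', hρ'⟩ := hi'
  refine ⟨q ∘ₗ ρ' ∘ₗ g, ?_⟩
  calc (q ∘ₗ ρ' ∘ₗ g) ∘ₗ i = q ∘ₗ (ρ' ∘ₗ i') ∘ₗ j := by simp only [LinearMap.comp_assoc, hg]
    _ = LinearMap.id := by rw [hρ', LinearMap.id_comp, hqj]

section Purity

variable {R : Type u} [CommRing R] {M X Y : Type*} [AddCommGroup M] [Module R M]
  [AddCommGroup X] [Module R X] [AddCommGroup Y] [Module R Y]

/-- A pure monomorphism of modules. Purity is tested on finitely generated modules only; this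
includes `R` itself, so that `i` is injective. -/
def IsPureInjective (i : M →ₗ[R] X) : Prop :=
  ∀ (N : Type u) [AddCommGroup N] [Module R N] [Module.Finite R N],
    Function.Injective (i.rTensor N)

namespace IsPureInjective

variable {i : M →ₗ[R] X}

theorem injective (hi : IsPureInjective i) : Function.Injective i := by
  have h : i ∘ₗ (TensorProduct.rid R M).toLinearMap =
      (TensorProduct.rid R X).toLinearMap ∘ₗ i.rTensor R := TensorProduct.ext' fun _ _ => by simp
  have h' : Function.Injective (i ∘ₗ (TensorProduct.rid R M).toLinearMap) := by
    rw [h]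
    exact (TensorProduct.rid R X).injective.comp (hi R)
  exact (EquivLike.injective_comp (TensorProduct.rid R M) i).1 h'

theorem of_comp {g : X →ₗ[R] Y} (h : IsPureInjective (g ∘ₗ i)) : IsPureInjective i :=
  fun N _ _ _ => .of_comp (f := g.rTensor N) <| by
    rw [← LinearMap.coe_comp, ← LinearMap.rTensor_comp]
    exact h N

end IsPureInjective

/-- Under `Hom(F, -) ≅ F* ⊗ -`, precomposition with `A` becomes `A* ⊗ -`, whose cokernel is
`coker A* ⊗ -`. -/
theorem exists_comp_eq_of_lTensor_injective {F₀ F₁ : Type*} [AddCommGroup F₀] [Module R F₀]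
    [Module.Finite R F₀] [Module.Projective R F₀] [AddCommGroup F₁] [Module R F₁]
    [Module.Finite R F₁] [Module.Projective R F₁] {A : F₁ →ₗ[R] F₀} {i : M →ₗ[R] X}
    (hi : Function.Injective (i.lTensor (Module.Dual R F₁ ⧸ LinearMap.range A.dualMap)))
    {w : F₁ →ₗ[R] M} {v : F₀ →ₗ[R] X} (hwv : i ∘ₗ w = v ∘ₗ A) :
    ∃ u : F₀ →ₗ[R] M, u ∘ₗ A = w := by
  obtain ⟨w, rfl⟩ := (dualTensorHom_bijective (R := R) (M := F₁) (N := M)).surjective w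
  obtain ⟨v, rfl⟩ := (dualTensorHom_bijective (R := R) (M := F₀) (N := X)).surjective v
  have hwv' : i.lTensor _ w = A.dualMap.rTensor X v := by
    apply (dualTensorHom_bijective (R := R) (M := F₁) (N := X)).injective
    exact (LinearMap.congr_fun (dualTensorHom_comp_lTensor i) w).trans
      (hwv.trans (LinearMap.congr_fun (dualTensorHom_comp_rTensor_dualMap A) v).symm)
  set c := (LinearMap.range A.dualMap).mkQ
  have hcA : c ∘ₗ A.dualMap = 0 := LinearMap.range_mkQ_comp _
  have hcw : c.rTensor M w = 0 := by
    refine hi ?_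
    calc i.lTensor _ (c.rTensor M w) = c.rTensor X (i.lTensor _ w) := by
          rw [← LinearMap.comp_apply, ← LinearMap.comp_apply, LinearMap.lTensor_comp_rTensor,
            LinearMap.rTensor_comp_lTensor]
      _ = i.lTensor _ 0 := by
          rw [hwv', ← LinearMap.rTensor_comp_apply, hcA, LinearMap.rTensor_zero,
            LinearMap.zero_apply, map_zero]
  obtain ⟨u, rfl⟩ := (rTensor_exact M (LinearMap.exact_map_mkQ_range A.dualMap)
    (Submodule.mkQ_surjective _) w).1 hcw
  exact ⟨dualTensorHom R F₀ M u,
    (LinearMap.congr_fun (dualTensorHom_comp_rTensor_dualMap A) u).symm⟩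

theorem IsPureInjective.isSplitInjective {i : M →ₗ[R] X} (hi : IsPureInjective i)
    [Module.FinitePresentation R (X ⧸ LinearMap.range i)] : IsSplitInjective i := by
  obtain ⟨n, m, q, A, hq, hAq⟩ :=
    Module.FinitePresentation.exists_fin' R (X ⧸ LinearMap.range i)
  obtain ⟨v, rfl⟩ :=
    Module.projective_lifting_property (LinearMap.range i).mkQ q (Submodule.mkQ_surjective _)
  have hvA : ∀ y, v (A y) ∈ LinearMap.range i := fun y =>
    (Submodule.Quotient.mk_eq_zero _).1 (hAq.apply_apply_eq_zero y)
  obtain ⟨w, hw⟩ := Module.projective_lifting_property i.rangeRestrict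
    ((v ∘ₗ A).codRestrict _ hvA) i.surjective_rangeRestrict
  have hiw : i ∘ₗ w = v ∘ₗ A :=
    LinearMap.ext fun y => congrArg Subtype.val (LinearMap.congr_fun hw y)
  obtain ⟨u, rfl⟩ := exists_comp_eq_of_lTensor_injective
    ((i.lTensor_inj_iff_rTensor_inj _).2 (hi _)) hiw
  have hsA : LinearMap.range A ≤ LinearMap.ker (v - i ∘ₗ u) := by
    rintro _ ⟨y, rfl⟩
    exact sub_eq_zero.2 (LinearMap.congr_fun hiw y).symm
  -- `v - i ∘ u` descends to a section of the projection onto the cokernel.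
  let s := (LinearMap.range A).liftQ _ hsA ∘ₗ (hAq.linearEquivOfSurjective hq).symm.toLinearMap
  have hs : (LinearMap.range i).mkQ ∘ₗ s = LinearMap.id := by
    refine LinearMap.ext fun x => ?_
    obtain ⟨y, rfl⟩ := hq x
    have hy := hAq.linearEquivOfSurjective_symm_apply hq y
    simp only [s, LinearMap.comp_apply, LinearEquiv.coe_coe] at hy ⊢
    rw [hy, Submodule.liftQ_apply]
    simp
  exact (((Function.Exact.split_tfae' (LinearMap.exact_map_mkQ_range i)).out 0 1 rfl rfl).1
    ⟨hi.injective, s, hs⟩).2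

end Purity

section TwoTermResolution

variable {C D : Type*} [Category* C] [Category* D] [Abelian C] [Abelian D]

open HomologicalComplex

theorem exactAt_one_iff_mono {K : ChainComplex C ℕ} (hK : Limits.IsZero (K.X 2)) :
    K.ExactAt 1 ↔ Mono (K.d 1 0) := by
  rw [exactAt_iff' _ 2 1 0 (by simp) (by simp)]
  exact ShortComplex.exact_iff_mono _ (hK.eq_of_src _ _)

/-- The chain complex `⋯ → 0 → A → B` of a morphism `A ⟶ B`, with `B` in degree `0`. -/
abbrev twoTermComplex {A B : C} (f : A ⟶ B) : ChainComplex C ℕ :=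
  double f (c := ComplexShape.down ℕ) (i₀ := 1) (i₁ := 0) rfl

section

variable {A B : C} (f : A ⟶ B)

/-- The term of `twoTermComplex` in degree `1`, which is the source only up to isomorphism. -/
abbrev twoTermComplexXOneIso : (twoTermComplex f).X 1 ≅ A :=
  doubleXIso₀ f rfl

/-- The term of `twoTermComplex` in degree `0`, which is the target only up to isomorphism. -/
abbrev twoTermComplexXZeroIso : (twoTermComplex f).X 0 ≅ B :=
  doubleXIso₁ f rfl one_ne_zero

theorem isZero_twoTermComplex_X_add_two (n : ℕ) : Limits.IsZero ((twoTermComplex f).X (n + 2)) :=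
  isZero_double_X f _ _ (by simp) (by simp)

theorem twoTermComplex_d : (twoTermComplex f).d 1 0 =
    (twoTermComplexXOneIso f).hom ≫ f ≫ (twoTermComplexXZeroIso f).inv :=
  double_d f rfl one_ne_zero

theorem twoTermComplex_exactAt_one [Mono f] : (twoTermComplex f).ExactAt 1 := by
  rw [exactAt_one_iff_mono (isZero_twoTermComplex_X_add_two f 0), twoTermComplex_d]
  infer_instance

end

/-- The augmentation of `⋯ → 0 → X₁ → X₂` by `X₂ → X₃`. -/
def twoTermAugmentation (S : ShortComplex C) :
    twoTermComplex S.f ⟶ (ChainComplex.single₀ C).obj S.X₃ :=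
  (ChainComplex.toSingle₀Equiv _ _).symm ⟨(twoTermComplexXZeroIso S.f).hom ≫ S.g, by
    rw [twoTermComplex_d, Category.assoc, Category.assoc, Iso.inv_hom_id_assoc, S.zero,
      Limits.comp_zero]⟩

theorem twoTermAugmentation_f_zero (S : ShortComplex C) :
    (twoTermAugmentation S).f 0 = (twoTermComplexXZeroIso S.f).hom ≫ S.g :=
  ChainComplex.toSingle₀Equiv_symm_apply_f_zero _ _

theorem quasiIso_twoTermAugmentation {S : ShortComplex C} (hS : S.ShortExact) :
    QuasiIso (twoTermAugmentation S) where
  quasiIsoAt n := by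
    have := hS.mono_f
    match n with
    | 0 =>
      have hd : (twoTermComplex S.f).d 0 0 = 0 := shape _ _ _ (by simp)
      rw [ChainComplex.quasiIsoAt₀_iff, ShortComplex.quasiIso_iff_of_zeros' _ hd rfl rfl]
      refine ⟨(ShortComplex.exact_iff_of_iso ?_).2 hS.exact, ?_⟩
      · refine ShortComplex.isoMk (twoTermComplexXOneIso S.f) (twoTermComplexXZeroIso S.f)
          (Iso.refl _) ?_ ?_
        · change _ = (twoTermComplex S.f).d 1 0 ≫ _
          rw [twoTermComplex_d, Category.assoc, Category.assoc, Iso.inv_hom_id, Category.comp_id]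
          rfl
        · exact (twoTermAugmentation_f_zero S).symm.trans (Category.comp_id _).symm
      · change Epi ((twoTermAugmentation S).f 0)
        rw [twoTermAugmentation_f_zero]
        exact (epi_comp_iff_of_epi (twoTermComplexXZeroIso S.f).hom S.g).2 hS.epi_g
    | 1 =>
      rw [quasiIsoAt_iff_exactAt' (hL := ChainComplex.exactAt_succ_single_obj ..)]
      exact twoTermComplex_exactAt_one S.f
    | n + 2 =>
      rw [quasiIsoAt_iff_exactAt' (hL := ChainComplex.exactAt_succ_single_obj ..)]
      exact .of_isZero (isZero_twoTermComplex_X_add_two S.f n)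

variable {S : ShortComplex C} (hS : S.ShortExact) [Projective S.X₁] [Projective S.X₂]

/-- A short exact sequence `0 → X₁ → X₂ → X₃ → 0` with `X₁` and `X₂` projective as a projective
resolution of `X₃`. -/
def twoTermResolution : ProjectiveResolution S.X₃ where
  complex := twoTermComplex S.f
  projective n := by
    match n with
    | 0 => exact .of_iso (twoTermComplexXZeroIso S.f).symm inferInstance
    | 1 => exact .of_iso (twoTermComplexXOneIso S.f).symm inferInstance
    | n + 2 => exact (isZero_twoTermComplex_X_add_two S.f n).projective
  π := twoTermAugmentation S
  quasiIso := quasiIso_twoTermAugmentation hS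

include hS in
theorem isZero_leftDerived_iff_mono_map [HasProjectiveResolutions C] (F : C ⥤ D) [F.Additive] :
    (∀ i : ℕ, 0 < i → Limits.IsZero ((F.leftDerived i).obj S.X₃)) ↔ Mono (F.map S.f) := by
  let K := (F.mapHomologicalComplex (ComplexShape.down ℕ)).obj (twoTermComplex S.f)
  have hK (n : ℕ) : Limits.IsZero (K.X (n + 2)) :=
    F.map_isZero (isZero_twoTermComplex_X_add_two S.f n)
  have hK₁ : K.ExactAt 1 ↔ Mono (F.map S.f) := by
    rw [exactAt_one_iff_mono (hK 0)]
    change Mono (F.map ((twoTermComplex S.f).d 1 0)) ↔ _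
    rw [twoTermComplex_d, F.map_comp, F.map_comp, mono_comp_iff_of_isIso, mono_comp_iff_of_mono]
  have hF (i : ℕ) : Limits.IsZero ((F.leftDerived i).obj S.X₃) ↔ K.ExactAt i := by
    rw [exactAt_iff_isZero_homology]
    exact ((twoTermResolution hS).isoLeftDerivedObj F i).isZero_iff
  simp only [hF, ← hK₁]
  refine ⟨fun h => h 1 one_pos, fun h i hi => ?_⟩
  match i with
  | 1 => exact h
  | i + 2 => exact .of_isZero (hK i)

end TwoTermResolution

namespace TorConnecting

section LeftDerivedZero

variable {C D : Type*} [Category* C] [Category* D] [Abelian C] [Abelian D]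
  [HasProjectiveResolutions C] {F G : C ⥤ D} [F.Additive] [G.Additive]

theorem leftDerived_comp_fromLeftDerivedZero (α : F ⟶ G) (X : C) :
    (NatTrans.leftDerived α 0).app X ≫ G.fromLeftDerivedZero.app X =
      F.fromLeftDerivedZero.app X ≫ α.app X := by
  let Q := projectiveResolution X
  let φ := (NatTrans.mapHomologicalComplex α (ComplexShape.down ℕ)).app Q.complex
  have hφ : HomologicalComplex.opcyclesMap φ 0 ≫ Q.fromLeftDerivedZero' G =
      Q.fromLeftDerivedZero' F ≫ α.app X := by
    rw [← cancel_epi (HomologicalComplex.pOpcycles _ _), HomologicalComplex.p_opcyclesMap_assoc,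
      ProjectiveResolution.pOpcycles_comp_fromLeftDerivedZero',
      ProjectiveResolution.pOpcycles_comp_fromLeftDerivedZero'_assoc]
    exact (α.naturality (Q.π.f 0)).symm
  have hι : HomologicalComplex.homologyMap φ 0 ≫ (ChainComplex.isoHomologyι₀ _).hom ≫
        Q.fromLeftDerivedZero' G =
      (ChainComplex.isoHomologyι₀ _).hom ≫ Q.fromLeftDerivedZero' F ≫ α.app X := by
    rw [← hφ]
    exact HomologicalComplex.homologyι_naturality_assoc φ 0 _
  rw [Q.leftDerived_app_eq, Q.fromLeftDerivedZero_eq, Q.fromLeftDerivedZero_eq]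
  simp only [Category.assoc, Iso.inv_hom_id_assoc]
  exact congrArg (_ ≫ ·) (hι.trans (Category.assoc _ _ _).symm)

theorem mono_leftDerived_zero_app_iff [Limits.PreservesFiniteColimits F]
    [Limits.PreservesFiniteColimits G] (α : F ⟶ G) (X : C) :
    Mono ((NatTrans.leftDerived α 0).app X) ↔ Mono (α.app X) := by
  rw [← mono_comp_iff_of_mono _ (G.fromLeftDerivedZero.app X),
    leftDerived_comp_fromLeftDerivedZero, mono_comp_iff_of_isIso]

end LeftDerivedZero

variable {R : Type u} [CommRing R] {S : ShortComplex (ModuleCat.{u} R)} (hS : S.ShortExact)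
  (N : ModuleCat.{u} R)

theorem torδ_eq_zero_iff (n : ℕ) :
    torδ hS N n = 0 ↔ Mono (((Tor (ModuleCat.{u} R) n).map S.f).app N) := by
  let Q := projectiveResolution N
  let e (X : ModuleCat.{u} R) := Q.isoLeftDerivedObj ((tensoringLeft (ModuleCat.{u} R)).obj X)
  have hδ : torδ hS N n = 0 ↔ (complexes_shortExact hS N).δ (n + 1) n rfl = 0 :=
    (Preadditive.IsIso.comp_left_eq_zero (e S.X₃ (n + 1)).hom _).trans
      (Preadditive.IsIso.comp_right_eq_zero _ (e S.X₁ n).inv)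
  have hTor : Mono (((Tor (ModuleCat.{u} R) n).map S.f).app N) ↔
      Mono (HomologicalComplex.homologyMap (complexes S N).f n) := by
    rw [Tor_map, Q.leftDerived_app_eq]
    exact (mono_comp_iff_of_isIso (e S.X₁ n).hom _).trans
      (mono_comp_iff_of_mono _ (e S.X₂ n).inv)
  rw [hδ, hTor]
  exact ((complexes_shortExact hS N).homology_exact₁ (n + 1) n rfl).mono_g_iff.symm

theorem torδ_eq_zero_of_isSplitMono [IsSplitMono S.f] (n : ℕ) :
    torδ hS N n = 0 :=
  (torδ_eq_zero_iff hS N n).2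
    (inferInstanceAs (Mono (((Tor (ModuleCat.{u} R) n ⋙ (evaluation _ _).obj N).map S.f))))

theorem torδ_zero_eq_zero_iff : torδ hS N 0 = 0 ↔ Mono (S.f ▷ N) := by
  have (X : ModuleCat.{u} R) :
      Limits.PreservesFiniteColimits ((tensoringLeft (ModuleCat.{u} R)).obj X) :=
    inferInstanceAs (Limits.PreservesFiniteColimits (tensorLeft X))
  rw [torδ_eq_zero_iff]
  exact mono_leftDerived_zero_app_iff ((tensoringLeft (ModuleCat.{u} R)).map S.f) N

theorem isZero_tor_succ_of_flat (X : ModuleCat.{u} R) [Module.Flat R X] (n : ℕ) :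
    Limits.IsZero (((Tor (ModuleCat.{u} R) (n + 1)).obj X).obj N) := by
  refine .of_iso ?_ ((projectiveResolution N).isoLeftDerivedObj
    ((tensoringLeft (ModuleCat.{u} R)).obj X) (n + 1))
  refine HomologicalComplex.ExactAt.isZero_homology ?_
  rw [HomologicalComplex.exactAt_iff' _ (n + 2) (n + 1) n (by simp) (by simp),
    ShortComplex.ShortExact.moduleCat_exact_iff_function_exact]
  exact Module.Flat.lTensor_exact X
    ((ShortComplex.ShortExact.moduleCat_exact_iff_function_exact _).1
      ((projectiveResolution N).exact_succ n))

theorem epi_torδ_succ [Module.Flat R S.X₂] (n : ℕ) : Epi (torδ hS N (n + 1)) := by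
  let Q := projectiveResolution N
  have hX₂ : Limits.IsZero ((complexes S N).X₂.homology (n + 1)) :=
    (isZero_tor_succ_of_flat N S.X₂ n).of_iso (Q.isoLeftDerivedObj
      ((tensoringLeft (ModuleCat.{u} R)).obj S.X₂) (n + 1)).symm
  have hδ : Epi ((complexes_shortExact hS N).δ (n + 1 + 1) (n + 1) rfl) :=
    ((complexes_shortExact hS N).homology_exact₁ _ _ rfl).epi_f (hX₂.eq_of_tgt _ _)
  exact (epi_comp_iff_of_epi (Q.isoLeftDerivedObj _ _).hom _).2
    ((epi_comp_iff_of_isIso _ (Q.isoLeftDerivedObj _ _).inv).2 hδ)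

end TorConnecting

namespace ChangeOfRings

variable {T : Type u} [CommRing T] {f : T}

section Naturality

variable {M M' : Type u} [AddCommGroup M] [Module T M] [Module (T ⧸ Ideal.span {f}) M]
  [IsScalarTower T (T ⧸ Ideal.span {f}) M] [AddCommGroup M'] [Module T M']
  [Module (T ⧸ Ideal.span {f}) M'] [IsScalarTower T (T ⧸ Ideal.span {f}) M']
  {P P' : Type u} [AddCommGroup P] [Module T P] [AddCommGroup P'] [Module T P']
  {p : P →ₗ[T] M} {p' : P' →ₗ[T] M'}

theorem exists_comp_theta_eq_theta_comp [Module.Projective T P] (hp : Function.Surjective p)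
    (hp' : Function.Surjective p') (j : M →ₗ[T ⧸ Ideal.span {f}] M') :
    ∃ g : QuotSMulTop f (LinearMap.ker p) →ₗ[T ⧸ Ideal.span {f}] QuotSMulTop f (LinearMap.ker p'),
      g ∘ₗ theta f p hp = theta f p' hp' ∘ₗ j := by
  obtain ⟨φ, hφ⟩ := Module.projective_lifting_property p' (j.restrictScalars T ∘ₗ p) hp'
  replace hφ (x) : p' (φ x) = j (p x) := LinearMap.congr_fun hφ x
  have hφ_ker : ∀ x ∈ LinearMap.ker p, φ x ∈ LinearMap.ker p' := fun x hx => by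
    rw [LinearMap.mem_ker, hφ, LinearMap.mem_ker.1 hx, map_zero]
  refine ⟨LinearMap.extendScalarsOfSurjective (algebraMap_surjective f)
    (QuotSMulTop.map f (φ.restrict hφ_ker)), LinearMap.ext fun m => ?_⟩
  obtain ⟨x, rfl⟩ := hp m
  rw [LinearMap.comp_apply, LinearMap.comp_apply, ← hφ, theta_apply, theta_apply]
  exact congrArg Submodule.Quotient.mk (Subtype.ext (map_smul φ f x))

theorem isSplitInjective_theta_of_retract [Module.Projective T P] (hp : Function.Surjective p)
    (hp' : Function.Surjective p') (h : IsSplitInjective (theta f p' hp'))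
    {j : M →ₗ[T ⧸ Ideal.span {f}] M'} {q : M' →ₗ[T ⧸ Ideal.span {f}] M}
    (hqj : q ∘ₗ j = LinearMap.id) : IsSplitInjective (theta f p hp) :=
  have ⟨_, hg⟩ := exists_comp_theta_eq_theta_comp hp hp' j
  h.of_retract hg hqj

end Naturality

section Reduction

variable (f) (L : Type u) [AddCommGroup L] [Module T L]

/-- The reduction `L / fL` as the base change of `L` to `T / (f)`. -/
def baseChangeEquiv :
    TensorProduct T (T ⧸ Ideal.span {f}) L ≃ₗ[T ⧸ Ideal.span {f}] QuotSMulTop f L :=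
  LinearEquiv.extendScalarsOfSurjective (algebraMap_surjective f)
    (QuotSMulTop.equivQuotTensor f L).symm

variable {f L}

/-- The splitting is induced by division by `f` on `fL`, the kernel of `L → L / fL`. -/
theorem isSplitInjective_theta_mkQ (hf : IsSMulRegular L f) :
    IsSplitInjective (theta f (M := QuotSMulTop f L) (f • (⊤ : Submodule T L)).mkQ
      (Submodule.mkQ_surjective _)) := by
  have h_ker : LinearMap.ker (f • (⊤ : Submodule T L)).mkQ ≤
      LinearMap.range (LinearMap.lsmul T L f) := by
    rw [Submodule.ker_mkQ, LinearMap.range_eq_map]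
    rfl
  let div : LinearMap.ker (f • (⊤ : Submodule T L)).mkQ →ₗ[T] L :=
    (LinearEquiv.ofInjective (LinearMap.lsmul T L f) hf).symm.toLinearMap ∘ₗ
      Submodule.inclusion h_ker
  have hdiv (x : L) (hx) : div ⟨f • x, hx⟩ = x := (LinearEquiv.symm_apply_eq _).2 rfl
  refine ⟨LinearMap.extendScalarsOfSurjective (algebraMap_surjective f) (QuotSMulTop.map f div),
    LinearMap.ext fun m => ?_⟩
  obtain ⟨x, rfl⟩ := Submodule.mkQ_surjective _ m
  rw [LinearMap.comp_apply, theta_apply]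
  exact congrArg Submodule.Quotient.mk (hdiv x _)

theorem flat_quotSMulTop [Module.Flat T L] :
    Module.Flat (T ⧸ Ideal.span {f}) (QuotSMulTop f L) :=
  .of_linearEquiv (baseChangeEquiv f L).symm

theorem finitePresentation_quotSMulTop [Module.FinitePresentation T L] :
    Module.FinitePresentation (T ⧸ Ideal.span {f}) (QuotSMulTop f L) :=
  .of_equiv (baseChangeEquiv f L)

theorem finite_quotSMulTop [Module.Finite T L] :
    Module.Finite (T ⧸ Ideal.span {f}) (QuotSMulTop f L) :=
  .equiv (baseChangeEquiv f L)

theorem injective_lTensor_lsmul_iff :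
    Function.Injective ((LinearMap.lsmul T T f).lTensor L) ↔ IsSMulRegular L f := by
  have h : (LinearMap.lsmul T T f).lTensor L = f • LinearMap.id :=
    (LinearMap.lTensor_smul L f LinearMap.id).trans (by rw [LinearMap.lTensor_id])
  rw [h]
  exact (TensorProduct.rid T L).isSMulRegular_congr f

/-- The short exact sequence `0 → T → T → T / (f) → 0` of multiplication by `f`. -/
def smulSeq (f : T) : ShortComplex (ModuleCat.{u} T) :=
  ShortComplex.mk (ModuleCat.ofHom (LinearMap.lsmul T T f))
    (ModuleCat.ofHom (Ideal.span {f}).mkQ) (by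
      refine ModuleCat.hom_ext (LinearMap.ext fun (x : T) => ?_)
      exact (Submodule.Quotient.mk_eq_zero _).2
        (Ideal.mul_mem_right x _ (Ideal.mem_span_singleton_self f)))

theorem smulSeq_shortExact (hf : f ∈ nonZeroDivisors T) : (smulSeq f).ShortExact where
  exact := by
    rw [ShortComplex.ShortExact.moduleCat_exact_iff_function_exact]
    intro (x : T)
    refine (Submodule.Quotient.mk_eq_zero _).trans ?_
    rw [Ideal.mem_span_singleton']
    exact exists_congr fun y => by rw [mul_comm]; rfl
  mono_f :=
    have hf_reg : IsSMulRegular T f := Module.Flat.isSMulRegular_of_nonZeroDivisors hf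
    (ModuleCat.mono_iff_injective _).2 hf_reg
  epi_g := (ModuleCat.epi_iff_surjective _).2 (Submodule.mkQ_surjective _)

theorem isZero_tor_iff_isSMulRegular (hf : f ∈ nonZeroDivisors T) :
    (∀ i : ℕ, 0 < i → Limits.IsZero (((Tor (ModuleCat.{u} T) i).obj (ModuleCat.of T L)).obj
      (ModuleCat.of T (T ⧸ Ideal.span {f})))) ↔ IsSMulRegular L f := by
  have hT : Projective (ModuleCat.of T T) :=
    (IsProjective.iff_projective T).1 inferInstance
  have : Projective (smulSeq f).X₁ := hT
  have : Projective (smulSeq f).X₂ := hT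
  refine (isZero_leftDerived_iff_mono_map (smulSeq_shortExact hf)
    ((tensoringLeft (ModuleCat.{u} T)).obj (ModuleCat.of T L))).trans ?_
  exact (ModuleCat.mono_iff_injective _).trans injective_lTensor_lsmul_iff

end Reduction

section Theta

variable {M : Type u} [AddCommGroup M] [Module T M] [Module (T ⧸ Ideal.span {f}) M]
  [IsScalarTower T (T ⧸ Ideal.span {f}) M] {P : Type u} [AddCommGroup P] [Module T P]
  {p : P →ₗ[T] M} (hp : Function.Surjective p)

theorem finitePresentation_coker_theta [Module.Finite (T ⧸ Ideal.span {f}) M]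
    [Module.FinitePresentation T (LinearMap.ker p)] :
    Module.FinitePresentation (T ⧸ Ideal.span {f})
      (QuotSMulTop f (LinearMap.ker p) ⧸ LinearMap.range (theta f p hp)) := by
  have : Module.FinitePresentation (T ⧸ Ideal.span {f}) (QuotSMulTop f (LinearMap.ker p)) :=
    finitePresentation_quotSMulTop
  refine Module.finitePresentation_of_surjective (LinearMap.range (theta f p hp)).mkQ
    (Submodule.mkQ_surjective _) ?_
  rw [Submodule.ker_mkQ]
  exact Module.Finite.iff_fg.1 inferInstance

theorem isWeaklyLiftable_of_isSplitInjective_theta [Module.Flat T P]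
    (hf : f ∈ nonZeroDivisors T) [Module.Finite T (LinearMap.ker p)]
    (h : IsSplitInjective (theta f p hp)) :
    IsWeaklyLiftable T (T ⧸ Ideal.span {f}) M := by
  obtain ⟨ρ, hρ⟩ := h
  have hW : IsSMulRegular (LinearMap.ker p) f :=
    (Module.Flat.isSMulRegular_of_nonZeroDivisors hf).submodule _ _
  exact ⟨QuotSMulTop f (LinearMap.ker p), inferInstance, inferInstance, finite_quotSMulTop,
    ⟨LinearMap.ker p, inferInstance, inferInstance, inferInstance, ⟨baseChangeEquiv f _⟩,
      (isZero_tor_iff_isSMulRegular hf).2 hW⟩, theta f p hp, ρ, hρ⟩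

variable [Module.Projective T P]

theorem isSplitInjective_theta_of_isWeaklyLiftable (hf : f ∈ nonZeroDivisors T)
    (h : IsWeaklyLiftable T (T ⧸ Ideal.span {f}) M) : IsSplitInjective (theta f p hp) := by
  obtain ⟨L, _, _, -, ⟨L', _, _, -, ⟨e⟩, hL'⟩, j, q, hqj⟩ := h
  let e' := (baseChangeEquiv f L').symm.trans e
  refine isSplitInjective_theta_of_retract hp (Submodule.mkQ_surjective _)
    (isSplitInjective_theta_mkQ ((isZero_tor_iff_isSMulRegular hf).1 hL'))
    (j := e'.symm.toLinearMap ∘ₗ j) (q := q ∘ₗ e'.toLinearMap) ?_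
  simpa [LinearMap.ext_iff] using hqj

theorem alpha_eq_zero_of_isSplitInjective_theta (hf : f ∈ nonZeroDivisors T)
    (h : IsSplitInjective (theta f p hp)) (N : Type u) [AddCommGroup N]
    [Module (T ⧸ Ideal.span {f}) N] (i : ℕ) : alpha p hf hp N i = 0 := by
  obtain ⟨ρ, hρ⟩ := h
  have : IsSplitMono (leftSeq f p hp).f :=
    ⟨⟨⟨ModuleCat.ofHom ρ, ModuleCat.hom_ext hρ⟩⟩⟩
  have hδ := TorConnecting.torδ_eq_zero_of_isSplitMono
    (leftSeq_shortExact p (Module.Flat.isSMulRegular_of_nonZeroDivisors hf) hp)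
    (ModuleCat.of _ N) i
  exact (congrArg (_ ≫ ·) hδ).trans Limits.comp_zero

theorem injective_rTensor_theta_of_alpha_eq_zero (hf : f ∈ nonZeroDivisors T) {N : Type u}
    [AddCommGroup N] [Module (T ⧸ Ideal.span {f}) N] (h : alpha p hf hp N 0 = 0) :
    Function.Injective ((theta f p hp).rTensor N) := by
  have : Module.Flat (T ⧸ Ideal.span {f}) (rightSeq f p).X₂ := flat_quotSMulTop (L := P)
  have := TorConnecting.epi_torδ_succ (rightSeq_shortExact (f := f) p hp) (ModuleCat.of _ N) 0
  have hδ : TorConnecting.torδ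
      (leftSeq_shortExact p (Module.Flat.isSMulRegular_of_nonZeroDivisors hf) hp)
      (ModuleCat.of _ N) 0 = 0 :=
    (cancel_epi (TorConnecting.torδ (rightSeq_shortExact (f := f) p hp)
      (ModuleCat.of _ N) (0 + 1))).1 (h.trans Limits.comp_zero.symm)
  exact (ModuleCat.mono_iff_injective _).1 ((TorConnecting.torδ_zero_eq_zero_iff _ _).1 hδ)

theorem isPureInjective_theta_of_alpha_eq_zero (hf : f ∈ nonZeroDivisors T)
    {F : Type u} [AddCommGroup F] [Module T F] [Module.Projective T F] {π : F →ₗ[T] M}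
    (hπ : Function.Surjective π)
    (h : ∀ (N : Type u) [AddCommGroup N] [Module (T ⧸ Ideal.span {f}) N]
      [Module.Finite (T ⧸ Ideal.span {f}) N], alpha p hf hp N 0 = 0) :
    IsPureInjective (theta f π hπ) := by
  obtain ⟨g, hg⟩ := exists_comp_theta_eq_theta_comp hπ hp (LinearMap.id (R := T ⧸ Ideal.span {f}))
  refine .of_comp (g := g) ?_
  rw [hg]
  exact fun N _ _ _ => injective_rTensor_theta_of_alpha_eq_zero hp hf (h N)

end Theta

end ChangeOfRings

end

theorem proposition3p1_general {T : Type u} [CommRing T] (f : T) (hf : f ∈ nonZeroDivisors T)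
    (M : Type u) [AddCommGroup M] [Module T M] [Module (T ⧸ Ideal.span {f}) M]
    [IsScalarTower T (T ⧸ Ideal.span {f}) M] [Module.Finite (T ⧸ Ideal.span {f}) M]
    {F : Type u} [AddCommGroup F] [Module T F] [Module.Projective T F] (π : F →ₗ[T] M)
    (hπ : Function.Surjective π) [Module.FinitePresentation T (LinearMap.ker π)]
    {P : Type u} [AddCommGroup P] [Module T P] [Module.Projective T P]
    (p : P →ₗ[T] M) (hp : Function.Surjective p) :
    List.TFAE [
      IsWeaklyLiftable T (T ⧸ Ideal.span {f}) M,
      ∃ ρ : QuotSMulTop f (LinearMap.ker π) →ₗ[T ⧸ Ideal.span {f}] M,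
        ρ ∘ₗ ChangeOfRings.theta f π hπ = LinearMap.id,
      ∀ (N : Type u) [AddCommGroup N] [Module (T ⧸ Ideal.span {f}) N]
        [Module.Finite (T ⧸ Ideal.span {f}) N],
        ChangeOfRings.alpha p hf hp N 0 = 0,
      ∀ (N : Type u) [AddCommGroup N] [Module (T ⧸ Ideal.span {f}) N]
        [Module.Finite (T ⧸ Ideal.span {f}) N] (i : ℕ),
        ChangeOfRings.alpha p hf hp N i = 0] := by
  open ChangeOfRings in
  tfae_have 1 → 2 := isSplitInjective_theta_of_isWeaklyLiftable hπ hf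
  tfae_have 2 → 1 := isWeaklyLiftable_of_isSplitInjective_theta hπ hf
  tfae_have 2 → 4 := fun h N _ _ _ =>
    have hp_split := isSplitInjective_theta_of_retract hp hπ h (LinearMap.id_comp LinearMap.id)
    alpha_eq_zero_of_isSplitInjective_theta hp hf hp_split N
  tfae_have 4 → 3 := fun h N _ _ _ => h N 0
  tfae_have 3 → 2 := fun h =>
    have := finitePresentation_coker_theta (f := f) hπ
    (isPureInjective_theta_of_alpha_eq_zero hp hf hπ h).isSplitInjective
  tfae_finish

theorem proposition3p1 {Λ : Type*} [CommRing Λ] [IsLocalRing Λ]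
    {T : Type u} [CommRing T] [IsNoetherianRing T] [Algebra Λ T]
    (f : T) (hf : f ∈ nonZeroDivisors T)
    (M : Type u) [AddCommGroup M] [Module T M] [Module (T ⧸ Ideal.span {f}) M]
    [IsScalarTower T (T ⧸ Ideal.span {f}) M] [Module.Finite (T ⧸ Ideal.span {f}) M]
    -- the free cover that defines the first syzygy of `M` over `T`, the kernel of `π`
    {a : ℕ} (π : (Fin a → T) →ₗ[T] M) (hπ : Function.Surjective π)
    -- a projective cover from which the connecting maps are computed
    {P : Type u} [AddCommGroup P] [Module T P] [Module.Projective T P]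
    (p : P →ₗ[T] M) (hp : Function.Surjective p) :
    List.TFAE [
      IsWeaklyLiftable T (T ⧸ Ideal.span {f}) M,
      ∃ ρ : QuotSMulTop f (LinearMap.ker π) →ₗ[T ⧸ Ideal.span {f}] M,
        ρ ∘ₗ ChangeOfRings.theta f π hπ = LinearMap.id,
      ∀ (N : Type u) [AddCommGroup N] [Module (T ⧸ Ideal.span {f}) N]
        [Module.Finite (T ⧸ Ideal.span {f}) N],
        ChangeOfRings.alpha p hf hp N 0 = 0,
      ∀ (N : Type u) [AddCommGroup N] [Module (T ⧸ Ideal.span {f}) N]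
        [Module.Finite (T ⧸ Ideal.span {f}) N] (i : ℕ),
        ChangeOfRings.alpha p hf hp N i = 0] := by
  have := Module.finitePresentation_of_finite T (LinearMap.ker π)
  exact proposition3p1_general f hf M π hπ p hp
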